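/- Let $p$ be an odd prime, let $\mathbb{Z}_p$ be the ring of $p$-adic integers and $\mathbb{Q}_p$ its field of fractions. For $n\ge 0$ let $(x)_n=x(x+1)\cdots(x+n-1)$ denote the shifted factorial (with $(x)_0=1$). Let $\Gamma_p:\mathbb{Z}_p\to\mathbb{Z}_p$ be Morita's $p$-adic Gamma function, defined by $\Gamma_p(0)=1$, $\Gamma_p(n)=(-1)^n\prod_{1\le k<n,\ p\nmid k}k$ for positive integers $n$, and $\Gamma_p(x)=\lim_{n\in\mathbb{N},\ |x-n|_p\to 0}\Gamma_p(n)$ for $x\in\mathbb{Z}_p$. For $a,b\in\mathbb{Q}_p$, write $a\equiv b\pmod{p^k}$ if $a-b\in p^k\mathbb{Z}_p$. If $p\equiv 1\pmod 6$, then $$\frac{(2/3)_{(p-1)/3}^3}{(1)_{(p-1)/3}^3}\left\{1+p^2\sum_{j=1}^{(p-1)/3}\left(\frac{1}{(3j-1)^2}-\frac{1}{(3j)^2}\right)\right\}\equiv -\Gamma_p(1/3)^9\pmod{p^4}.$$ If $p\equiv 5\pmod 6$, then $$\frac{(2/3)_{(2p-1)/3}^3}{(1)_{(2p-1)/3}^3}\equiv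 -\frac{p^3}{27}\,\Gamma_p(1/3)^9\pmod{p^5}.$$ -/

import Mathlib

/-- Morita's `p`-adic Gamma function on the natural numbers:
`Γ_p(0) = 1` and `Γ_p(n) = (-1)^n ∏_{1 ≤ k < n, p ∤ k} k` for `n ≥ 1`
(for `n = 0` the product is empty and the formula gives `1`). -/
def moritaGammaNat (p n : ℕ) : ℤ :=
  (-1) ^ n * ∏ k ∈ (Finset.Ico 1 n).filter (fun k => ¬ p ∣ k), (k : ℤ)

/-- Morita's `p`-adic Gamma function on `ℤ_p`: the limit of `Γ_p(n)` as the natural number `n`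
tends `p`-adically to `x`. (For an odd prime `p` this limit exists for every `x`.) -/
noncomputable def moritaGamma (p : ℕ) [Fact p.Prime] (x : ℤ_[p]) : ℤ_[p] :=
  Filter.limUnder (Filter.comap (fun n : ℕ => (n : ℤ_[p])) (nhds x))
    (fun n : ℕ => (moritaGammaNat p n : ℤ_[p]))

/-- The shifted factorial `(x)_n = x (x + 1) ⋯ (x + n - 1)`. -/
noncomputable def shiftedFactorial {K : Type*} [Field K] (x : K) (n : ℕ) : K :=
  (ascPochhammer K n).eval x

/-- `a ≡ b (mod p^k)` for `p`-adic numbers: `a - b` lies in `p^k ℤ_p`. -/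
def PadicModEq (p : ℕ) [Fact p.Prime] (k : ℕ) (a b : ℚ_[p]) : Prop :=
  ∃ c : ℤ_[p], a - b = (p : ℚ_[p]) ^ k * (c : ℚ_[p])

/-- The `p`-adic integer `1/3`. (`PadicInt.inv` is the genuine inverse on units, so this is meant
for `p ≠ 3`.) -/
noncomputable def oneThird (p : ℕ) [Fact p.Prime] : ℤ_[p] :=
  PadicInt.inv (3 : ℤ_[p])

theorem three_mul_oneThird (p : ℕ) [Fact p.Prime] (hp : p ≠ 3) :
    (3 : ℤ_[p]) * oneThird p = 1 := by
  apply PadicInt.mul_inv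
  have h : ¬ ‖((3 : ℕ) : ℤ_[p])‖ < 1 := by
    rw [PadicInt.norm_natCast_lt_one_iff]
    intro h
    exact hp ((Nat.prime_dvd_prime_iff_eq Fact.out Nat.prime_three).1 h)
  exact le_antisymm (PadicInt.norm_le_one _) (by simpa using h)

/-! Write t = 1/3 and, for p | y, D(x) = Γ_p(x+y) Γ_p(x-y) / Γ_p(x)² (`gammaRatio`). Choose y with
2t + m = t + y, so y = p/3 or y = 2p/3. The functional equation and reflection give (2/3)_m / (1)_m
= -Γ_p(t)³ D(t), apart from factors divisible by p (`prod_unitPart_eq`). It remains to estimate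
D(t)³.

Since D(0) = 1 and D(x+1) = D(x)(1 - y²/x²), with no change at non-units x, D ≡ 1 mod p². This
settles p ≡ 5, where the single non-unit factor p/3 contributes p³/27 after cubing.

For p ≡ 1, work mod p⁴, where y⁴ = 0 and the steps become additive. Inverse cubes sum to 0 mod p
over a period, so D(x+pz) is D(x) times a function affine in z, and D(t+y) D(t-y) ≡ D(t)². Stepping
from 2t to t+y and from 1 to 1-(t-y), with D(x) D(1-x) = 1, evaluates D(t)³ as 1 - p²S, where S is
the sum in the statement (`toZModPow_gammaRatio_cube`). -/

/-! ### Wilson's theorem modulo odd prime powers. -/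

/-- A product over `n` consecutive residues modulo `n` is a product over all residues. -/
theorem prod_range_add_eq_prod_zmod {M : Type*} [CommMonoid M] (n : ℕ) [NeZero n] (a : ZMod n)
    (g : ZMod n → M) : ∏ i ∈ Finset.range n, g (a + i) = ∏ z, g z := by
  refine Finset.prod_nbij (fun i : ℕ => a + (i : ZMod n)) (by simp) ?_ ?_ (by simp)
  · intro i hi j hj hij
    have h : (i : ZMod n) = j := add_left_cancel hij
    rw [ZMod.natCast_eq_natCast_iff] at h
    exact h.eq_of_lt_of_lt (by simpa using hi) (by simpa using hj)
  · intro z _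
    exact ⟨(z - a).val, by simpa using ZMod.val_lt (z - a), by simp⟩

theorem sum_range_add_eq_sum_zmod {M : Type*} [AddCommMonoid M] (n : ℕ) [NeZero n] (a : ZMod n)
    (g : ZMod n → M) : ∑ i ∈ Finset.range n, g (a + i) = ∑ z, g z :=
  prod_range_add_eq_prod_zmod (M := Multiplicative M) n a g

/-- An odd p cannot divide both a - 1 and a + 1, so the whole power p^k divides one of them. -/
theorem ZMod.eq_one_or_neg_one_of_sq_eq_one {p k : ℕ} (hp : p.Prime) (h2 : p ≠ 2)
    {z : ZMod (p ^ k)} (hz : z * z = 1) : z = 1 ∨ z = -1 := by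
  obtain ⟨a, rfl⟩ := ZMod.intCast_surjective z
  have h : ((p ^ k : ℕ) : ℤ) ∣ (a - 1) * (a + 1) := by
    rw [← ZMod.intCast_zmod_eq_zero_iff_dvd]
    push_cast
    linear_combination hz
  have hpi : Prime (p : ℤ) := Nat.prime_iff_prime_int.1 hp
  push_cast at h
  by_cases hd : (p : ℤ) ∣ a + 1
  · right
    have hn : ¬ (p : ℤ) ∣ a - 1 := by
      intro h1
      have h3 : (p : ℤ) ∣ 2 := by
        have := dvd_sub hd h1
        ring_nf at this
        exact this
      have h4 : p ∣ 2 := by exact_mod_cast h3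
      exact h2 ((Nat.prime_dvd_prime_iff_eq hp Nat.prime_two).1 h4)
    have h5 := hpi.pow_dvd_of_dvd_mul_left k hn h
    have : ((a + 1 : ℤ) : ZMod (p ^ k)) = 0 := by
      rw [ZMod.intCast_zmod_eq_zero_iff_dvd]
      exact_mod_cast h5
    push_cast at this
    linear_combination this
  · left
    have h5 := hpi.pow_dvd_of_dvd_mul_right k hd h
    have : ((a - 1 : ℤ) : ZMod (p ^ k)) = 0 := by
      rw [ZMod.intCast_zmod_eq_zero_iff_dvd]
      exact_mod_cast h5
    push_cast at this
    linear_combination this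

/-- Wilson's theorem for odd prime powers. -/
theorem ZMod.prod_units_prime_pow {p k : ℕ} [Fact p.Prime] (h2 : p ≠ 2) :
    ∏ u : (ZMod (p ^ k))ˣ, u = -1 := by
  classical
  -- Pair u with its inverse, setting -1 aside; the only other self-inverse unit is 1, which
  -- contributes nothing.
  have key : ∏ u ∈ (Finset.univ : Finset (ZMod (p ^ k))ˣ).erase (-1), u = 1 := by
    refine Finset.prod_involution (fun u _ => u⁻¹) (by simp) ?_ ?_ (by simp)
    · intro u hu h1 h
      have hu' : (u : ZMod (p ^ k)) * u = 1 := by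
        rw [← Units.val_mul]
        nth_rewrite 1 [← h]
        simp
      rcases ZMod.eq_one_or_neg_one_of_sq_eq_one Fact.out h2 hu' with h3 | h3
      · exact h1 (Units.ext h3)
      · exact (Finset.ne_of_mem_erase hu) (Units.ext (by simpa using h3))
    · intro u hu
      simp only [Finset.mem_erase, Finset.mem_univ, and_true] at hu ⊢
      intro h
      exact hu (by rw [← inv_inv u, h]; simp)
  rw [← Finset.mul_prod_erase Finset.univ _ (Finset.mem_univ (-1 : (ZMod (p ^ k))ˣ)), key, mul_one]

theorem ZMod.prod_ite_isUnit_prime_pow {p k : ℕ} [Fact p.Prime] (h2 : p ≠ 2)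
    [DecidablePred (IsUnit : ZMod (p ^ k) → Prop)] :
    ∏ z : ZMod (p ^ k), (if IsUnit z then z else 1) = -1 := by
  have h := congrArg (fun u : (ZMod (p ^ k))ˣ => (u : ZMod (p ^ k)))
    (ZMod.prod_units_prime_pow (p := p) (k := k) h2)
  simp only [Units.coe_prod, Units.val_neg, Units.val_one] at h
  rw [← h, ← Finset.prod_filter]
  symm
  refine Finset.prod_nbij (fun u : (ZMod (p ^ k))ˣ => (u : ZMod (p ^ k))) (by simp) ?_ ?_ (by simp)
  · intro u _ v _ huv
    exact Units.ext huv
  · intro z hz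
    obtain ⟨u, hu⟩ : IsUnit z := by simpa using hz
    exact ⟨u, by simp, hu⟩

/-! ### Γ_p on the natural numbers and its p-adic continuity. -/

theorem moritaGammaNat_succ (p n : ℕ) :
    moritaGammaNat p (n + 1) = -(if p ∣ n then 1 else (n : ℤ)) * moritaGammaNat p n := by
  unfold moritaGammaNat
  rcases Nat.eq_zero_or_pos n with rfl | hn
  · simp
  · rw [Finset.prod_filter, Finset.prod_filter, Finset.prod_Ico_succ_top hn, pow_succ]
    by_cases h : p ∣ n
    · simp [h]
    · simp [h]; ring

theorem moritaGammaNat_add (p n m : ℕ) :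
    moritaGammaNat p (n + m) =
      moritaGammaNat p n * ∏ i ∈ Finset.range m, -(if p ∣ n + i then 1 else ((n + i : ℕ) : ℤ)) := by
  induction m with
  | zero => simp
  | succ m ih => rw [← add_assoc, moritaGammaNat_succ, ih, Finset.prod_range_succ]; ring

/-- The product of the integers prime to `p` in a window of length `p ^ k`. -/
theorem prod_window_prime_pow {p : ℕ} [Fact p.Prime] (h2 : p ≠ 2) {k : ℕ} (hk : 0 < k) (n : ℕ) :
    ∏ i ∈ Finset.range (p ^ k),
      ((if p ∣ n + i then 1 else ((n + i : ℕ) : ℤ) : ℤ) : ZMod (p ^ k)) = -1 := by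
  classical
  have hp : p.Prime := Fact.out
  rw [← ZMod.prod_ite_isUnit_prime_pow h2,
    ← prod_range_add_eq_prod_zmod (p ^ k) (n : ZMod (p ^ k)) (fun z => if IsUnit z then z else 1)]
  refine Finset.prod_congr rfl fun i _ => ?_
  have : IsUnit ((n : ZMod (p ^ k)) + i) ↔ ¬ p ∣ n + i := by
    rw [← Nat.cast_add, ZMod.isUnit_iff_coprime, Nat.coprime_pow_right_iff hk, Nat.coprime_comm,
      hp.coprime_iff_not_dvd]
  by_cases hd : p ∣ n + i <;> simp [this, hd]

/-- The p^k signs multiply to -1, cancelling the -1 from Wilson's theorem. -/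
theorem moritaGammaNat_add_prime_pow {p : ℕ} [Fact p.Prime] (h2 : p ≠ 2) {k : ℕ} (hk : 0 < k)
    (n : ℕ) : (moritaGammaNat p (n + p ^ k) : ZMod (p ^ k)) = moritaGammaNat p n := by
  have hodd : Odd (p ^ k) := ((Fact.out : p.Prime).odd_of_ne_two h2).pow
  have hw := prod_window_prime_pow h2 hk n
  rw [moritaGammaNat_add, Int.cast_mul, Finset.prod_neg, Finset.card_range, hodd.neg_one_pow,
    Int.cast_mul, Int.cast_prod, hw]
  simp

theorem moritaGammaNat_congr {p : ℕ} [Fact p.Prime] (h2 : p ≠ 2) {k n m : ℕ}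
    (h : (n : ZMod (p ^ k)) = m) :
    (moritaGammaNat p n : ZMod (p ^ k)) = moritaGammaNat p m := by
  rcases Nat.eq_zero_or_pos k with hk | hk
  · have : Subsingleton (ZMod (p ^ k)) := by rw [hk, pow_zero]; infer_instance
    exact Subsingleton.elim _ _
  have aux : ∀ n j : ℕ, (moritaGammaNat p (n + p ^ k * j) : ZMod (p ^ k)) = moritaGammaNat p n := by
    intro n j
    induction j with
    | zero => simp
    | succ j ih => rw [Nat.mul_succ, ← add_assoc, moritaGammaNat_add_prime_pow h2 hk, ih]
  rw [ZMod.natCast_eq_natCast_iff'] at h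
  rw [← Nat.mod_add_div n (p ^ k), ← Nat.mod_add_div m (p ^ k), aux, aux, h]

/-! ### Reduction modulo p^k and existence of the limit. -/

namespace PadicInt

variable {p : ℕ} [Fact p.Prime]

theorem toZModPow_eq_iff_norm_le {k : ℕ} {x y : ℤ_[p]} :
    toZModPow k x = toZModPow k y ↔ ‖x - y‖ ≤ (p : ℝ) ^ (-k : ℤ) := by
  rw [norm_le_pow_iff_mem_span_pow, ← ker_toZModPow, RingHom.mem_ker, map_sub, sub_eq_zero]

theorem toZModPow_eq_iff_dvd {k : ℕ} {x y : ℤ_[p]} :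
    toZModPow k x = toZModPow k y ↔ (p : ℤ_[p]) ^ k ∣ x - y := by
  rw [← Ideal.mem_span_singleton, ← ker_toZModPow, RingHom.mem_ker, map_sub, sub_eq_zero]

theorem toZModPow_appr (x : ℤ_[p]) (k : ℕ) : toZModPow k x = (x.appr k : ZMod (p ^ k)) := by
  have h := toZModPow_eq_iff_dvd.2 (Ideal.mem_span_singleton.1 (appr_spec k x))
  simpa using h

theorem exists_nat_toZModPow_eq (x : ℤ_[p]) (k : ℕ) :
    ∃ n : ℕ, toZModPow k x = toZModPow k (n : ℤ_[p]) :=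
  ⟨x.appr k, by rw [toZModPow_appr, map_natCast]⟩

end PadicInt

open PadicInt

/-- The second conjunct, which fixes L modulo every p^k, is what later arguments use in place of the
limit. -/
theorem exists_tendsto_moritaGammaNat {p : ℕ} [Fact p.Prime] (h2 : p ≠ 2) (x : ℤ_[p]) :
    ∃ L : ℤ_[p], Filter.Tendsto (fun n : ℕ => (moritaGammaNat p n : ℤ_[p]))
      (Filter.comap (fun n : ℕ => (n : ℤ_[p])) (nhds x)) (nhds L) ∧
      ∀ (k n : ℕ), toZModPow k x = n → toZModPow k L = moritaGammaNat p n := by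
  have hseq : ∀ i, (p : ℤ) ^ i ∣ moritaGammaNat p (x.appr (i + 1)) - moritaGammaNat p (x.appr i) := by
    intro i
    have h : ((x.appr (i + 1) : ℕ) : ZMod (p ^ i)) = (x.appr i : ℕ) := by
      rw [eq_comm, ZMod.natCast_eq_natCast_iff]
      exact (Nat.modEq_iff_dvd' (appr_mono x (Nat.le_succ i))).2
        (dvd_appr_sub_appr x i (i + 1) (Nat.le_succ i))
    have h' := sub_eq_zero.2 (moritaGammaNat_congr h2 h)
    rw [← Int.cast_sub, ZMod.intCast_zmod_eq_zero_iff_dvd] at h'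
    exact_mod_cast h'
  have hL := toZModPow_ofIntSeq_of_pow_dvd_sub (fun i => moritaGammaNat p (x.appr i)) p hseq
  set L := ofIntSeq _ (isCauSeq_padicNorm_of_pow_dvd_sub
    (fun i => moritaGammaNat p (x.appr i)) p hseq)
  have hspec : ∀ (k n : ℕ), toZModPow k x = n → toZModPow k L = moritaGammaNat p n := by
    intro k n h
    rw [hL k]
    apply moritaGammaNat_congr h2
    rw [← h, toZModPow_appr]
  refine ⟨L, ?_, hspec⟩
  rw [Metric.tendsto_nhds]
  intro ε hε
  obtain ⟨k, hk⟩ := exists_pow_neg_lt p hε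
  have hball : {y : ℤ_[p] | ‖y - x‖ < (p : ℝ) ^ (-k : ℤ)} ∈ nhds x := by
    have hp : (0 : ℝ) < p := by exact_mod_cast (Fact.out : p.Prime).pos
    have := Metric.ball_mem_nhds x (zpow_pos hp (-k : ℤ))
    simpa [Metric.ball, dist_eq_norm] using this
  filter_upwards [Filter.preimage_mem_comap hball] with n hn
  have h1 : toZModPow k (n : ℤ_[p]) = toZModPow k x := toZModPow_eq_iff_norm_le.2 (le_of_lt hn)
  rw [dist_eq_norm]
  refine lt_of_le_of_lt (toZModPow_eq_iff_norm_le.1 ?_) hk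
  rw [hspec k n (by rw [← h1, map_natCast]), map_intCast]

/-! ### Functional equation of Γ_p on ℤ_p. -/

section moritaGamma

variable {p : ℕ} [Fact p.Prime]

theorem toZModPow_moritaGamma (h2 : p ≠ 2) {x : ℤ_[p]} {k n : ℕ}
    (h : toZModPow k x = toZModPow k (n : ℤ_[p])) :
    toZModPow k (moritaGamma p x) = moritaGammaNat p n := by
  obtain ⟨L, hL, hspec⟩ := exists_tendsto_moritaGammaNat h2 x
  -- Density of ℕ in ℤ_p makes the filter nontrivial, hence the limit unique.
  have : (Filter.comap (fun n : ℕ => (n : ℤ_[p])) (nhds x)).NeBot :=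
    Filter.comap_neBot_iff_frequently.2
      (mem_closure_iff_frequently.1 (denseRange_natCast x) |>.mono (by simp))
  have hlim : moritaGamma p x = L := hL.limUnder_eq
  rw [hlim]
  exact hspec k n (by rw [h, map_natCast])

theorem toZModPow_moritaGamma_congr (h2 : p ≠ 2) {x y : ℤ_[p]} {k : ℕ}
    (h : toZModPow k x = toZModPow k y) :
    toZModPow k (moritaGamma p x) = toZModPow k (moritaGamma p y) := by
  obtain ⟨n, hn⟩ := exists_nat_toZModPow_eq y k
  rw [toZModPow_moritaGamma h2 hn, toZModPow_moritaGamma h2 (h.trans hn)]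

theorem moritaGamma_natCast (h2 : p ≠ 2) (n : ℕ) : moritaGamma p n = moritaGammaNat p n := by
  rw [← ext_of_toZModPow]
  intro k
  rw [toZModPow_moritaGamma h2 rfl, map_intCast]

theorem moritaGamma_zero (h2 : p ≠ 2) : moritaGamma p 0 = 1 := by
  have := moritaGamma_natCast (p := p) h2 0
  simpa [moritaGammaNat] using this

/-- The exponent k + 1 excludes the modulus p^0, which cannot detect units. -/
theorem eq_of_forall_toZModPow_succ {x y : ℤ_[p]}
    (h : ∀ k, toZModPow (k + 1) x = toZModPow (k + 1) y) : x = y := by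
  rw [← ext_of_toZModPow]
  intro k
  have := h k
  rw [toZModPow_eq_iff_dvd] at this ⊢
  exact (pow_dvd_pow _ (Nat.le_succ k)).trans this

theorem PadicInt.isUnit_iff_not_prime_dvd {x : ℤ_[p]} : IsUnit x ↔ ¬ (p : ℤ_[p]) ∣ x := by
  rw [isUnit_iff, ← norm_lt_one_iff_dvd, not_lt]
  exact ⟨fun h => h.ge, fun h => le_antisymm (norm_le_one x) h⟩

theorem PadicInt.prime_dvd_iff_of_toZModPow_succ {x : ℤ_[p]} {k n : ℕ}
    (h : toZModPow (k + 1) x = toZModPow (k + 1) (n : ℤ_[p])) : (p : ℤ_[p]) ∣ x ↔ p ∣ n := by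
  have h' := (dvd_pow_self (p : ℤ_[p]) k.succ_ne_zero).trans (toZModPow_eq_iff_dvd.1 h)
  rw [(dvd_iff_dvd_of_dvd_sub h'), ← norm_lt_one_iff_dvd, norm_natCast_lt_one_iff]

theorem moritaGamma_add_one_of_isUnit (h2 : p ≠ 2) {x : ℤ_[p]} (hx : IsUnit x) :
    moritaGamma p (x + 1) = -x * moritaGamma p x := by
  refine eq_of_forall_toZModPow_succ fun k => ?_
  obtain ⟨n, hn⟩ := exists_nat_toZModPow_eq x (k + 1)
  have hd : ¬ p ∣ n := by
    rwa [← prime_dvd_iff_of_toZModPow_succ hn, ← isUnit_iff_not_prime_dvd]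
  rw [toZModPow_moritaGamma (n := n + 1) h2 (by push_cast; rw [map_add, hn, map_add]),
    map_mul, toZModPow_moritaGamma h2 hn, moritaGammaNat_succ, map_neg, hn]
  simp [hd]

theorem moritaGamma_add_one_of_not_isUnit (h2 : p ≠ 2) {x : ℤ_[p]} (hx : ¬ IsUnit x) :
    moritaGamma p (x + 1) = -moritaGamma p x := by
  refine eq_of_forall_toZModPow_succ fun k => ?_
  obtain ⟨n, hn⟩ := exists_nat_toZModPow_eq x (k + 1)
  have hd : p ∣ n := by
    rw [← prime_dvd_iff_of_toZModPow_succ hn]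
    rwa [isUnit_iff_not_prime_dvd, not_not] at hx
  rw [toZModPow_moritaGamma (n := n + 1) h2 (by push_cast; rw [map_add, hn, map_add]),
    map_neg, toZModPow_moritaGamma h2 hn, moritaGammaNat_succ]
  simp [hd]

end moritaGamma

/-! ### Sums of inverse powers over a period. -/

namespace PadicInt

variable {p : ℕ} [Fact p.Prime]

theorem mul_inv_of_isUnit {x : ℤ_[p]} (hx : IsUnit x) : x * x.inv = 1 :=
  mul_inv (isUnit_iff.1 hx)

/-- This default value makes sums of inverses skip the non-units, just as Γ_p does. -/
theorem inv_of_not_isUnit {x : ℤ_[p]} (hx : ¬ IsUnit x) : x.inv = 0 := by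
  rw [isUnit_iff] at hx
  cases x
  exact dif_neg hx

theorem coe_inv_of_isUnit {x : ℤ_[p]} (hx : IsUnit x) :
    ((x.inv : ℤ_[p]) : ℚ_[p]) = (x : ℚ_[p])⁻¹ := by
  apply eq_inv_of_mul_eq_one_right
  rw [← coe_mul, mul_inv_of_isUnit hx, coe_one]

theorem isUnit_add_iff_of_prime_dvd {x y : ℤ_[p]} (hy : (p : ℤ_[p]) ∣ y) :
    IsUnit (x + y) ↔ IsUnit x := by
  rw [isUnit_iff_not_prime_dvd, isUnit_iff_not_prime_dvd, dvd_add_left hy]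

theorem toZMod_eq_zero_iff_dvd {x : ℤ_[p]} : toZMod x = 0 ↔ (p : ℤ_[p]) ∣ x := by
  rw [← RingHom.mem_ker, ker_toZMod, maximalIdeal_eq_span_p, Ideal.mem_span_singleton]

theorem toZMod_inv (x : ℤ_[p]) : toZMod x.inv = (toZMod x)⁻¹ := by
  by_cases hx : IsUnit x
  · apply eq_inv_of_mul_eq_one_right
    rw [← map_mul, mul_inv_of_isUnit hx, map_one]
  · rw [inv_of_not_isUnit hx, map_zero]
    rw [isUnit_iff_not_prime_dvd, not_not] at hx
    rw [toZMod_eq_zero_iff_dvd.2 hx, inv_zero]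

/-- Modulo p the terms run over all residues, inversion permutes them (with 0⁻¹ = 0), and cubes sum
to 0 because 3 < p - 1. -/
theorem prime_dvd_sum_inv_cube (hp : 5 ≤ p) (x : ℤ_[p]) :
    (p : ℤ_[p]) ∣ ∑ i ∈ Finset.range p, (x + i).inv ^ 3 := by
  rw [← toZMod_eq_zero_iff_dvd, map_sum]
  simp only [map_pow, toZMod_inv, map_add, map_natCast]
  rw [sum_range_add_eq_sum_zmod p (toZMod x) (fun z => z⁻¹ ^ 3)]
  rw [Fintype.sum_equiv (Equiv.inv (ZMod p)) (fun z : ZMod p => z⁻¹ ^ 3) (fun z => z ^ 3) (by simp)]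
  exact FiniteField.sum_pow_lt_card_sub_one (ZMod p) 3 (by rw [ZMod.card]; omega)

/-- First-order expansion of (u+p)⁻²; at a non-unit every term is 0. -/
theorem inv_add_prime_sq_sub (u : ℤ_[p]) :
    (p : ℤ_[p]) ^ 2 ∣ (u + p).inv ^ 2 - u.inv ^ 2 + 2 * p * u.inv ^ 3 := by
  by_cases hu : IsUnit u
  · have hv := mul_inv_of_isUnit hu
    have hw := mul_inv_of_isUnit ((isUnit_add_iff_of_prime_dvd (dvd_refl (p : ℤ_[p]))).2 hu)
    set v := u.inv
    set w := (u + p).inv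
    have h : w = v - p * v * w := by linear_combination (-w) * hv + v * hw
    refine ⟨3 * v ^ 3 * w - p * v ^ 3 * w ^ 2, ?_⟩
    have h' : w ^ 2 - v ^ 2 = -(p * v * (v - p * v * w) * (2 * v - p * v * w)) := by
      rw [← h]
      linear_combination (w + v - p * v * w) * h
    rw [h']
    ring
  · have hu' := fun h => hu ((isUnit_add_iff_of_prime_dvd (dvd_refl (p : ℤ_[p]))).1 h)
    simp [inv_of_not_isUnit hu, inv_of_not_isUnit hu']

/-- The sum of the inverse squares of the units among `x, x + 1, …, x + n - 1`. -/
noncomputable def sumInvSq (n : ℕ) (x : ℤ_[p]) : ℤ_[p] :=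
  ∑ i ∈ Finset.range n, (x + i).inv ^ 2

theorem prime_sq_dvd_sumInvSq_add_sub (hp : 5 ≤ p) (x : ℤ_[p]) :
    (p : ℤ_[p]) ^ 2 ∣ sumInvSq p (x + p : ℤ_[p]) - sumInvSq p x := by
  have h1 : (p : ℤ_[p]) ^ 2 ∣ ∑ i ∈ Finset.range p,
      ((x + p + i : ℤ_[p]).inv ^ 2 - (x + i : ℤ_[p]).inv ^ 2 +
        2 * p * (x + i : ℤ_[p]).inv ^ 3) := by
    refine Finset.dvd_sum fun i _ => ?_
    rw [add_right_comm]
    exact inv_add_prime_sq_sub (x + i : ℤ_[p])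
  have h2 : (p : ℤ_[p]) ^ 2 ∣ ∑ i ∈ Finset.range p, 2 * p * (x + i : ℤ_[p]).inv ^ 3 := by
    rw [← Finset.mul_sum, sq]
    exact mul_dvd_mul (dvd_mul_left _ _) (prime_dvd_sum_inv_cube hp x)
  rw [Finset.sum_add_distrib, Finset.sum_sub_distrib] at h1
  exact (dvd_add_left h2).1 h1

end PadicInt

/-! ### Reflection, and the second difference D modulo p⁴. -/

section moritaGamma

variable {p : ℕ} [Fact p.Prime]

/-- A step x → x + 1 changes the product only by a sign, which squaring removes; induction from 0
and density of ℕ finish. -/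
theorem moritaGamma_reflection_sq (h2 : p ≠ 2) (x : ℤ_[p]) :
    (moritaGamma p x * moritaGamma p (1 - x)) ^ 2 = 1 := by
  have hstep : ∀ x : ℤ_[p], (moritaGamma p (x + 1) * moritaGamma p (1 - (x + 1))) ^ 2 =
      (moritaGamma p x * moritaGamma p (1 - x)) ^ 2 := by
    intro x
    have e1 : 1 - (x + 1) = -x := by ring
    have e2 : 1 - x = -x + 1 := by ring
    rw [e1, e2]
    by_cases hx : IsUnit x
    · rw [moritaGamma_add_one_of_isUnit h2 hx, moritaGamma_add_one_of_isUnit h2 hx.neg]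
      ring
    · rw [moritaGamma_add_one_of_not_isUnit h2 hx,
        moritaGamma_add_one_of_not_isUnit h2 (fun h => hx (by simpa using h.neg))]
      ring
  have hnat : ∀ n : ℕ, (moritaGamma p n * moritaGamma p (1 - n)) ^ 2 = 1 := by
    intro n
    induction n with
    | zero =>
      have h := moritaGamma_add_one_of_not_isUnit (p := p) h2 not_isUnit_zero
      rw [zero_add] at h
      simp [h, moritaGamma_zero h2]
    | succ n ih => rw [Nat.cast_succ, hstep, ih]
  rw [← ext_of_toZModPow]
  intro k
  obtain ⟨n, hn⟩ := exists_nat_toZModPow_eq x k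
  rw [map_pow, map_mul, toZModPow_moritaGamma_congr h2 hn,
    toZModPow_moritaGamma_congr h2 (x := 1 - x) (y := 1 - n) (by rw [map_sub, map_sub, hn]),
    ← map_mul, ← map_pow, hnat]

theorem isUnit_moritaGamma (h2 : p ≠ 2) (x : ℤ_[p]) : IsUnit (moritaGamma p x) := by
  refine IsUnit.of_mul_eq_one (moritaGamma p x * moritaGamma p (1 - x) ^ 2) ?_
  linear_combination moritaGamma_reflection_sq h2 x

/-- The reflection product `Γ_p(x) Γ_p(1 - x)` depends only on `x` modulo `p`. -/
theorem moritaGamma_reflection_congr (h2 : p ≠ 2) {x y : ℤ_[p]} (h : (p : ℤ_[p]) ∣ x - y) :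
    moritaGamma p x * moritaGamma p (1 - x) = moritaGamma p y * moritaGamma p (1 - y) := by
  have h1 : toZModPow 1 x = toZModPow 1 y := toZModPow_eq_iff_dvd.2 (by simpa using h)
  have h3 : toZModPow 1 (moritaGamma p x * moritaGamma p (1 - x)) =
      toZModPow 1 (moritaGamma p y * moritaGamma p (1 - y)) := by
    rw [map_mul, map_mul, toZModPow_moritaGamma_congr h2 h1,
      toZModPow_moritaGamma_congr h2 (x := 1 - x) (y := 1 - y) (by rw [map_sub, map_sub, h1])]
  have hx := moritaGamma_reflection_sq h2 x
  have hy := moritaGamma_reflection_sq h2 y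
  generalize moritaGamma p x * moritaGamma p (1 - x) = a at *
  generalize moritaGamma p y * moritaGamma p (1 - y) = b at *
  -- Both products square to 1 and agree mod p; opposite signs would force p | 2.
  rcases sq_eq_sq_iff_eq_or_eq_neg.1 (hx.trans hy.symm) with hab | hab
  · exact hab
  · exfalso
    rw [toZModPow_eq_iff_dvd, pow_one, hab] at h3
    have hb : IsUnit b := IsUnit.of_mul_eq_one b (by rw [← sq, hy])
    have h4 : (p : ℤ_[p]) ∣ (2 : ℕ) := by
      have : ((2 : ℕ) : ℤ_[p]) = (-b - b) * -b := by push_cast; linear_combination (-2) * hy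
      rw [this]
      exact h3.mul_right _
    rw [← norm_lt_one_iff_dvd, norm_natCast_lt_one_iff] at h4
    exact h2 ((Nat.prime_dvd_prime_iff_eq Fact.out Nat.prime_two).1 h4)

/-- The multiplicative second difference `Γ_p(x + y) Γ_p(x - y) / Γ_p(x)²`. -/
noncomputable def gammaRatio (p : ℕ) [Fact p.Prime] (y x : ℤ_[p]) : ℤ_[p] :=
  moritaGamma p (x + y) * moritaGamma p (x - y) * (moritaGamma p x).inv ^ 2

theorem gammaRatio_mul_sq (h2 : p ≠ 2) (y x : ℤ_[p]) :
    gammaRatio p y x * moritaGamma p x ^ 2 = moritaGamma p (x + y) * moritaGamma p (x - y) := by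
  have h := mul_inv_of_isUnit (isUnit_moritaGamma h2 x)
  unfold gammaRatio
  generalize (moritaGamma p x).inv = v at *
  linear_combination
    moritaGamma p (x + y) * moritaGamma p (x - y) * (moritaGamma p x * v + 1) * h

theorem gammaRatio_zero (h2 : p ≠ 2) {y : ℤ_[p]} (hy : (p : ℤ_[p]) ∣ y) :
    gammaRatio p y 0 = 1 := by
  have h := gammaRatio_mul_sq h2 y 0
  have hr := moritaGamma_reflection_congr h2 (x := y) (y := 0) (by simpa using hy)
  have h1 := moritaGamma_add_one_of_not_isUnit (p := p) h2 not_isUnit_zero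
  have h3 := moritaGamma_add_one_of_not_isUnit (p := p) (x := -y) h2
    (by rw [isUnit_iff_not_prime_dvd, not_not, dvd_neg]; exact hy)
  have e : 1 - y = -y + 1 := by ring
  rw [e, h3, sub_zero, ← zero_add (1 : ℤ_[p]), h1, moritaGamma_zero h2] at hr
  rw [zero_add, zero_sub, moritaGamma_zero h2] at h
  linear_combination h - hr

/-- As p | y, the elements x, x + y, x - y are units together; otherwise all three steps are sign
changes and `x.inv` is 0. -/
theorem gammaRatio_add_one (h2 : p ≠ 2) {y : ℤ_[p]} (hy : (p : ℤ_[p]) ∣ y) (x : ℤ_[p]) :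
    gammaRatio p y (x + 1) = gammaRatio p y x * (1 - y ^ 2 * x.inv ^ 2) := by
  have hne : moritaGamma p (x + 1) ^ 2 ≠ 0 := pow_ne_zero _ (isUnit_moritaGamma h2 _).ne_zero
  apply mul_right_cancel₀ hne
  rw [gammaRatio_mul_sq h2]
  have h := gammaRatio_mul_sq h2 y x
  have e1 : x + 1 + y = x + y + 1 := by ring
  have e2 : x + 1 - y = x - y + 1 := by ring
  have hp := isUnit_add_iff_of_prime_dvd (x := x) hy
  have hm := isUnit_add_iff_of_prime_dvd (x := x) ((dvd_neg (b := y)).2 hy)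
  rw [← sub_eq_add_neg] at hm
  rw [e1, e2]
  by_cases hx : IsUnit x
  · rw [moritaGamma_add_one_of_isUnit h2 hx, moritaGamma_add_one_of_isUnit h2 (hp.2 hx),
      moritaGamma_add_one_of_isUnit h2 (hm.2 hx)]
    have hv := mul_inv_of_isUnit hx
    generalize x.inv = v at *
    linear_combination (-(x ^ 2 - y ^ 2)) * h +
      gammaRatio p y x * moritaGamma p x ^ 2 * y ^ 2 * (x * v + 1) * hv
  · rw [moritaGamma_add_one_of_not_isUnit h2 hx,
      moritaGamma_add_one_of_not_isUnit h2 (fun h => hx (hp.1 h)),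
      moritaGamma_add_one_of_not_isUnit h2 (fun h => hx (hm.1 h)), inv_of_not_isUnit hx]
    linear_combination -h

/-- The reflection products at x + y and x - y both equal the one at x, whose square is 1. -/
theorem gammaRatio_reflection (h2 : p ≠ 2) {y : ℤ_[p]} (hy : (p : ℤ_[p]) ∣ y) (x : ℤ_[p]) :
    gammaRatio p y x * gammaRatio p y (1 - x) = 1 := by
  have h := gammaRatio_mul_sq h2 y x
  have h' := gammaRatio_mul_sq h2 y (1 - x)
  have e1 : 1 - x + y = 1 - (x - y) := by ring
  have e2 : 1 - x - y = 1 - (x + y) := by ring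
  rw [e1, e2] at h'
  have r0 := moritaGamma_reflection_sq h2 x
  have r1 := moritaGamma_reflection_congr h2 (x := x + y) (y := x) (by simpa using hy)
  have r2 := moritaGamma_reflection_congr h2 (x := x - y) (y := x) (by simpa using hy)
  calc gammaRatio p y x * gammaRatio p y (1 - x)
      = (gammaRatio p y x * moritaGamma p x ^ 2) *
          (gammaRatio p y (1 - x) * moritaGamma p (1 - x) ^ 2) := by
        linear_combination (-(gammaRatio p y x * gammaRatio p y (1 - x))) * r0
    _ = (moritaGamma p (x + y) * moritaGamma p (1 - (x + y))) *
          (moritaGamma p (x - y) * moritaGamma p (1 - (x - y))) := by rw [h, h']; ring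
    _ = 1 := by rw [r1, r2, ← sq, r0]

theorem toZModPow_gammaRatio_congr (h2 : p ≠ 2) (y : ℤ_[p]) {x x' : ℤ_[p]} {k : ℕ}
    (h : toZModPow k x = toZModPow k x') :
    toZModPow k (gammaRatio p y x) = toZModPow k (gammaRatio p y x') := by
  have hu : IsUnit (toZModPow k (moritaGamma p x' ^ 2)) :=
    ((isUnit_moritaGamma h2 x').pow 2).map _
  apply hu.mul_right_cancel
  rw [← map_mul (toZModPow k) (gammaRatio p y x'), gammaRatio_mul_sq h2, map_pow,
    ← toZModPow_moritaGamma_congr h2 h, ← map_pow, ← map_mul, gammaRatio_mul_sq h2, map_mul, map_mul,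
    toZModPow_moritaGamma_congr h2 (x := x + y) (y := x' + y) (by rw [map_add, map_add, h]),
    toZModPow_moritaGamma_congr h2 (x := x - y) (y := x' - y) (by rw [map_sub, map_sub, h])]

theorem prime_sq_dvd_gammaRatio_sub_one (h2 : p ≠ 2) {y : ℤ_[p]} (hy : (p : ℤ_[p]) ∣ y)
    (x : ℤ_[p]) : (p : ℤ_[p]) ^ 2 ∣ gammaRatio p y x - 1 := by
  have hnat : ∀ n : ℕ, (p : ℤ_[p]) ^ 2 ∣ gammaRatio p y n - 1 := by
    intro n
    induction n with
    | zero => simp [gammaRatio_zero h2 hy]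
    | succ n ih =>
      rw [Nat.cast_succ, gammaRatio_add_one h2 hy]
      have h3 : (p : ℤ_[p]) ^ 2 ∣ y ^ 2 * (gammaRatio p y n * (n : ℤ_[p]).inv ^ 2) :=
        (pow_dvd_pow_of_dvd hy 2).mul_right _
      have h4 := dvd_sub ih h3
      ring_nf at h4 ⊢
      exact h4
  obtain ⟨n, hn⟩ := exists_nat_toZModPow_eq x 2
  rw [← toZModPow_eq_iff_dvd, toZModPow_gammaRatio_congr h2 y hn, toZModPow_eq_iff_dvd]
  exact hnat n

theorem toZModPow_four_pow_four_eq_zero {y : ℤ_[p]} (hy : (p : ℤ_[p]) ∣ y) :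
    toZModPow 4 y ^ 4 = 0 := by
  rw [← map_pow, ← map_zero (toZModPow 4), toZModPow_eq_iff_dvd, sub_zero]
  exact pow_dvd_pow_of_dvd hy 4

theorem toZModPow_gammaRatio_add_nat (h2 : p ≠ 2) {y : ℤ_[p]} (hy : (p : ℤ_[p]) ∣ y) (x : ℤ_[p])
    (n : ℕ) : toZModPow 4 (gammaRatio p y (x + n)) =
      toZModPow 4 (gammaRatio p y x) * (1 - toZModPow 4 y ^ 2 * toZModPow 4 (sumInvSq n x)) := by
  have hy4 := toZModPow_four_pow_four_eq_zero hy
  induction n with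
  | zero => simp [sumInvSq]
  | succ n ih =>
    have hs : sumInvSq (n + 1) x = sumInvSq n x + (x + n).inv ^ 2 := Finset.sum_range_succ _ _
    rw [Nat.cast_succ, ← add_assoc, gammaRatio_add_one h2 hy, map_mul, ih, hs]
    simp only [map_sub, map_one, map_mul, map_pow, map_add]
    linear_combination toZModPow 4 (gammaRatio p y x) * toZModPow 4 (sumInvSq n x) *
      toZModPow 4 (x + n).inv ^ 2 * hy4

theorem toZModPow_sq_mul_sumInvSq (hp : 5 ≤ p) {y : ℤ_[p]} (hy : (p : ℤ_[p]) ∣ y) (x : ℤ_[p])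
    (k : ℕ) : toZModPow 4 y ^ 2 * toZModPow 4 (sumInvSq p (x + p * k : ℤ_[p])) =
      toZModPow 4 y ^ 2 * toZModPow 4 (sumInvSq p x) := by
  rw [← map_pow, ← map_mul, ← map_mul, toZModPow_eq_iff_dvd, ← mul_sub,
    show (p : ℤ_[p]) ^ 4 = (p : ℤ_[p]) ^ 2 * (p : ℤ_[p]) ^ 2 by ring]
  refine mul_dvd_mul (pow_dvd_pow_of_dvd hy 2) ?_
  induction k with
  | zero => simp
  | succ k ih =>
    have := dvd_add (prime_sq_dvd_sumInvSq_add_sub hp (x + p * k)) ih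
    rw [sub_add_sub_cancel] at this
    convert this using 3
    push_cast
    ring

/-- Each shift by p contributes the same factor mod p⁴, and y⁴ = 0 linearises the powers of that
factor. -/
theorem toZModPow_gammaRatio_add_prime_mul (hp : 5 ≤ p) {y : ℤ_[p]} (hy : (p : ℤ_[p]) ∣ y)
    (x z : ℤ_[p]) : toZModPow 4 (gammaRatio p y (x + p * z)) = toZModPow 4 (gammaRatio p y x) *
      (1 - toZModPow 4 z * (toZModPow 4 y ^ 2 * toZModPow 4 (sumInvSq p x))) := by
  have h2 : p ≠ 2 := by omega
  have hy4 := toZModPow_four_pow_four_eq_zero hy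
  obtain ⟨n, hn⟩ := exists_nat_toZModPow_eq z 4
  rw [toZModPow_gammaRatio_congr h2 y (x' := x + p * n) (by simp only [map_add, map_mul, hn]), hn,
    map_natCast]
  clear hn
  induction n with
  | zero => simp
  | succ n ih =>
    have e : x + p * ((n + 1 : ℕ) : ℤ_[p]) = x + p * n + p := by push_cast; ring
    rw [e, toZModPow_gammaRatio_add_nat h2 hy, toZModPow_sq_mul_sumInvSq hp hy, ih]
    push_cast
    linear_combination toZModPow 4 (gammaRatio p y x) * n * toZModPow 4 (sumInvSq p x) ^ 2 * hy4

theorem toZModPow_gammaRatio_mul_symm (hp : 5 ≤ p) {y : ℤ_[p]} (hy : (p : ℤ_[p]) ∣ y)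
    (x z : ℤ_[p]) :
    toZModPow 4 (gammaRatio p y (x + p * z)) * toZModPow 4 (gammaRatio p y (x - p * z)) =
      toZModPow 4 (gammaRatio p y x) ^ 2 := by
  have hy4 := toZModPow_four_pow_four_eq_zero hy
  have h1 := toZModPow_gammaRatio_add_prime_mul hp hy x z
  have h3 := toZModPow_gammaRatio_add_prime_mul hp hy x (-z)
  rw [mul_neg, ← sub_eq_add_neg, map_neg] at h3
  rw [h1, h3]
  linear_combination (-(toZModPow 4 (gammaRatio p y x) ^ 2 * toZModPow 4 z ^ 2 *
    toZModPow 4 (sumInvSq p x) ^ 2)) * hy4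

end moritaGamma

/-! ### Shifted factorials in terms of Γ_p and D. -/

section

variable {p : ℕ} [Fact p.Prime]

theorem shiftedFactorial_eq_prod {K : Type*} [Field K] (x : K) (n : ℕ) :
    shiftedFactorial x n = ∏ i ∈ Finset.range n, (x + i) := by
  unfold shiftedFactorial
  induction n with
  | zero => simp
  | succ n ih => rw [ascPochhammer_succ_eval, ih, Finset.prod_range_succ]

/-- `x` itself if `x` is a unit, and `1` otherwise. -/
noncomputable def PadicInt.unitPart (x : ℤ_[p]) : ℤ_[p] :=
  open Classical in if IsUnit x then x else 1

theorem PadicInt.unitPart_of_isUnit {x : ℤ_[p]} (hx : IsUnit x) : x.unitPart = x := if_pos hx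

theorem PadicInt.unitPart_of_not_isUnit {x : ℤ_[p]} (hx : ¬ IsUnit x) : x.unitPart = 1 :=
  if_neg hx

theorem moritaGamma_add_one (h2 : p ≠ 2) (x : ℤ_[p]) :
    moritaGamma p (x + 1) = -x.unitPart * moritaGamma p x := by
  by_cases hx : IsUnit x
  · rw [unitPart_of_isUnit hx, moritaGamma_add_one_of_isUnit h2 hx]
  · rw [unitPart_of_not_isUnit hx, moritaGamma_add_one_of_not_isUnit h2 hx, neg_one_mul]

theorem moritaGamma_add_nat (h2 : p ≠ 2) (x : ℤ_[p]) (n : ℕ) :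
    moritaGamma p (x + n) =
      (-1) ^ n * (∏ i ∈ Finset.range n, (x + i).unitPart) * moritaGamma p x := by
  induction n with
  | zero => simp
  | succ n ih =>
    rw [Nat.cast_succ, ← add_assoc, moritaGamma_add_one h2, ih, Finset.prod_range_succ]
    ring

theorem moritaGamma_one (h2 : p ≠ 2) : moritaGamma p 1 = -1 := by
  have h := moritaGamma_add_one_of_not_isUnit (p := p) h2 not_isUnit_zero
  rwa [zero_add, moritaGamma_zero h2] at h

theorem prod_unitPart_eq (h2 : p ≠ 2) {t y : ℤ_[p]} (ht : 3 * t = 1) (hy : (p : ℤ_[p]) ∣ y)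
    {m : ℕ} (hm : 2 * t + m = t + y) :
    ∏ i ∈ Finset.range m, (2 * t + i).unitPart =
      -(moritaGamma p t ^ 3 * gammaRatio p y t) *
        ∏ i ∈ Finset.range m, (1 + (i : ℤ_[p])).unitPart := by
  have hN := moritaGamma_add_nat h2 (2 * t) m
  have hM := moritaGamma_add_nat (p := p) h2 1 m
  have e1 : 1 + (m : ℤ_[p]) = 1 - (t - y) := by linear_combination hm
  have e2 : 2 * t = 1 - t := by linear_combination ht
  rw [hm] at hN
  rw [e1, moritaGamma_one h2] at hM
  have hsq := moritaGamma_reflection_sq h2 t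
  have hr := moritaGamma_reflection_congr h2 (x := t - y) (y := t) (by simpa using hy)
  rw [← e2] at hsq hr
  have hD := gammaRatio_mul_sq h2 y t
  have hs : ((-1 : ℤ_[p]) ^ m) ^ 2 = 1 := by rw [← pow_mul, mul_comm, pow_mul]; simp
  generalize (∏ i ∈ Finset.range m, (2 * t + i).unitPart) = N at *
  generalize (∏ i ∈ Finset.range m, (1 + (i : ℤ_[p])).unitPart) = M at *
  generalize (-1 : ℤ_[p]) ^ m = s at *
  generalize moritaGamma p (t + y) = gp at *
  generalize moritaGamma p (t - y) = gm at *
  generalize moritaGamma p (1 - (t - y)) = gr at *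
  generalize moritaGamma p (2 * t) = g2 at *
  generalize moritaGamma p t = g at *
  generalize gammaRatio p y t = D at *
  subst hN
  have hM' : M = -(s * gr) := by linear_combination s * hM - M * hs
  subst hM'
  -- Inserting s² and (Γ_p(t) Γ_p(2t))², both 1, lets reflection trade Γ_p(t) Γ_p(2t) for Γ_p(t-y)
  -- Γ_p(1-(t-y)).
  calc N = N * s ^ 2 * (g * g2) ^ 2 := by rw [hs, hsq]; ring
    _ = g * s * (gm * gr) * (s * N * g2) := by rw [hr]; ring
    _ = _ := by linear_combination (-(g * s * gr)) * hD

theorem toZModPow_gammaRatio_cube (hp : 5 ≤ p) {t : ℤ_[p]} (ht : 3 * t = 1) {m : ℕ}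
    (hm : 2 * t + m = t + p * t) :
    toZModPow 4 (gammaRatio p (p * t) t ^ 3 *
      (1 + (p : ℤ_[p]) ^ 2 * (t ^ 2 * (sumInvSq m (2 * t) - sumInvSq m 1)))) = toZModPow 4 1 := by
  have h2 : p ≠ 2 := by omega
  have hy : (p : ℤ_[p]) ∣ p * t := dvd_mul_right _ _
  have hA := toZModPow_gammaRatio_add_nat h2 hy (2 * t) m
  have hB := toZModPow_gammaRatio_add_nat h2 hy 1 m
  have e1 : 1 + (m : ℤ_[p]) = 1 - (t - p * t) := by linear_combination hm
  have e2 : 2 * t = 1 - t := by linear_combination ht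
  have hone : gammaRatio p (p * t) 1 = 1 := by
    have h := gammaRatio_add_one h2 hy 0
    rw [zero_add, gammaRatio_zero h2 hy, inv_of_not_isUnit not_isUnit_zero] at h
    simpa using h
  have r1 := congrArg (toZModPow 4) (gammaRatio_reflection h2 hy t)
  have r2 := congrArg (toZModPow 4) (gammaRatio_reflection h2 hy (t - p * t))
  have hsym := toZModPow_gammaRatio_mul_symm hp hy t t
  have hy4 := toZModPow_four_pow_four_eq_zero hy
  rw [hm] at hA
  rw [e1, hone, map_one, one_mul] at hB
  rw [← e2] at r1
  have hε : toZModPow 4 ((p : ℤ_[p]) ^ 2 * (t ^ 2 * (sumInvSq m (2 * t) - sumInvSq m 1))) =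
      toZModPow 4 (p * t : ℤ_[p]) ^ 2 *
        (toZModPow 4 (sumInvSq m (2 * t)) - toZModPow 4 (sumInvSq m 1)) := by
    simp only [map_mul, map_pow, map_sub]
    ring
  rw [map_mul, map_pow, map_add, hε, map_one]
  rw [map_mul, map_one] at r1 r2
  generalize toZModPow 4 (sumInvSq m (2 * t)) = A at *
  generalize toZModPow 4 (sumInvSq m (1 : ℤ_[p])) = B at *
  generalize toZModPow 4 (gammaRatio p (p * t) (t + p * t)) = dp at *
  generalize toZModPow 4 (gammaRatio p (p * t) (t - p * t)) = dm at *
  generalize toZModPow 4 (gammaRatio p (p * t) (1 - (t - p * t))) = dr at *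
  generalize toZModPow 4 (gammaRatio p (p * t) (2 * t)) = d2 at *
  generalize toZModPow 4 (gammaRatio p (p * t) t) = d at *
  generalize toZModPow 4 (p * t : ℤ_[p]) = e at *
  have hdm : dm = 1 + e ^ 2 * B := by
    rw [hB] at r2
    linear_combination (1 + e ^ 2 * B) * r2 + dm * B ^ 2 * hy4
  -- Split d² as D(t+y) D(t-y), then use D(t) D(2t) = 1.
  have hd : d ^ 3 = 1 - e ^ 2 * (A - B) := by
    calc d ^ 3 = d * (dp * dm) := by rw [hsym]; ring
      _ = (d * d2) * (1 - e ^ 2 * A) * (1 + e ^ 2 * B) := by rw [hA, hdm]; ring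
      _ = _ := by rw [r1]; linear_combination (-(A * B)) * hy4
  rw [hd]
  linear_combination (-(A - B) ^ 2) * hy4

theorem prime_dvd_two_thirds_add_iff {t : ℤ_[p]} (ht : 3 * t = 1) (i : ℕ) :
    (p : ℤ_[p]) ∣ 2 * t + i ↔ p ∣ 3 * i + 2 := by
  have h3 : IsUnit (3 : ℤ_[p]) := IsUnit.of_mul_eq_one _ ht
  have e : ((3 * i + 2 : ℕ) : ℤ_[p]) = 3 * (2 * t + i) := by
    push_cast
    linear_combination (-2) * ht
  rw [← norm_natCast_lt_one_iff (p := p), norm_lt_one_iff_dvd, e, h3.dvd_mul_left]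

theorem isUnit_one_add_nat {i : ℕ} (hi : i + 1 < p) : IsUnit (1 + (i : ℤ_[p])) := by
  rw [isUnit_iff_not_prime_dvd, add_comm, ← Nat.cast_succ, ← norm_lt_one_iff_dvd,
    norm_natCast_lt_one_iff]
  exact Nat.not_dvd_of_pos_of_lt i.succ_pos hi

theorem coe_eq_one_third {t : ℤ_[p]} (ht : 3 * t = 1) : (t : ℚ_[p]) = 1 / 3 := by
  have h : (3 : ℚ_[p]) * t = 1 := by exact_mod_cast congrArg (fun z : ℤ_[p] => (z : ℚ_[p])) ht
  rw [eq_div_iff (by norm_num)]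
  linear_combination h

theorem coe_two_mul_eq_two_thirds {t : ℤ_[p]} (ht : 3 * t = 1) :
    ((2 * t : ℤ_[p]) : ℚ_[p]) = 2 / 3 := by
  rw [two_mul, coe_add, coe_eq_one_third ht]
  ring

theorem shiftedFactorial_coe (x : ℤ_[p]) (m : ℕ) :
    shiftedFactorial (x : ℚ_[p]) m = ((∏ i ∈ Finset.range m, (x + i) : ℤ_[p]) : ℚ_[p]) := by
  rw [shiftedFactorial_eq_prod]
  have h := map_prod (PadicInt.Coe.ringHom (p := p)) (fun i : ℕ => x + (i : ℤ_[p])) (Finset.range m)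
  simp only [map_add, map_natCast] at h
  exact h.symm

theorem sum_inv_sq_sub_eq_coe {t : ℤ_[p]} (ht : 3 * t = 1) {m : ℕ}
    (hA : ∀ i < m, IsUnit (2 * t + (i : ℤ_[p]))) (hB : ∀ i < m, IsUnit (1 + (i : ℤ_[p]))) :
    ∑ j ∈ Finset.Icc 1 m, (1 / (3 * (j : ℚ_[p]) - 1) ^ 2 - 1 / (3 * (j : ℚ_[p])) ^ 2) =
      ((t ^ 2 * (sumInvSq m (2 * t) - sumInvSq m 1) : ℤ_[p]) : ℚ_[p]) := by
  have ht' := coe_eq_one_third ht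
  have hcoe : ((t ^ 2 * (sumInvSq m (2 * t) - sumInvSq m 1) : ℤ_[p]) : ℚ_[p]) =
      ∑ i ∈ Finset.range m, ((t ^ 2 * (2 * t + i).inv ^ 2 - t ^ 2 * (1 + (i : ℤ_[p])).inv ^ 2 :
        ℤ_[p]) : ℚ_[p]) := by
    unfold sumInvSq
    rw [← Finset.sum_sub_distrib, Finset.mul_sum]
    simp only [mul_sub]
    exact map_sum (PadicInt.Coe.ringHom (p := p)) _ _
  rw [hcoe, ← Finset.Ico_add_one_right_eq_Icc, Finset.sum_Ico_eq_sum_range, Nat.add_sub_cancel]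
  refine Finset.sum_congr rfl fun i hi => ?_
  have hi' := Finset.mem_range.1 hi
  rw [coe_sub, coe_mul, coe_mul, coe_pow, coe_pow, coe_pow, coe_inv_of_isUnit (hA i hi'),
    coe_inv_of_isUnit (hB i hi'), coe_add, coe_add, coe_two_mul_eq_two_thirds ht, ht', coe_natCast,
    coe_one, ← mul_pow, ← mul_pow, one_div, one_div, ← inv_pow, ← inv_pow, one_div, ← _root_.mul_inv,
    ← _root_.mul_inv]
  push_cast
  ring

theorem padicModEq_of_toZModPow {k : ℕ} {x y : ℤ_[p]} (h : toZModPow k x = toZModPow k y) :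
    PadicModEq p k x y := by
  obtain ⟨c, hc⟩ := toZModPow_eq_iff_dvd.1 h
  refine ⟨c, ?_⟩
  rw [← coe_sub, hc]
  push_cast
  rfl

end

/-! ### The two congruences. -/

theorem proposition1p8 (p : ℕ) [Fact p.Prime] :
    (p ≡ 1 [MOD 6] →
      PadicModEq p 4
        (shiftedFactorial (2 / 3 : ℚ_[p]) ((p - 1) / 3) ^ 3 /
            shiftedFactorial (1 : ℚ_[p]) ((p - 1) / 3) ^ 3 *
          (1 + (p : ℚ_[p]) ^ 2 *
            ∑ j ∈ Finset.Icc 1 ((p - 1) / 3),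
              (1 / (3 * (j : ℚ_[p]) - 1) ^ 2 - 1 / (3 * (j : ℚ_[p])) ^ 2)))
        (-(moritaGamma p (oneThird p) : ℚ_[p]) ^ 9)) ∧
    (p ≡ 5 [MOD 6] →
      PadicModEq p 5
        (shiftedFactorial (2 / 3 : ℚ_[p]) ((2 * p - 1) / 3) ^ 3 /
          shiftedFactorial (1 : ℚ_[p]) ((2 * p - 1) / 3) ^ 3)
        (-((p : ℚ_[p]) ^ 3 / 27) * (moritaGamma p (oneThird p) : ℚ_[p]) ^ 9)) := by
  have hp1 : 1 < p := (Fact.out : p.Prime).one_lt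
  constructor
  · intro hmod
    have hmod' : p % 6 = 1 := hmod
    have ht := three_mul_oneThird p (by omega)
    generalize oneThird p = t at *
    have h2 : p ≠ 2 := by omega
    have hpm : p = 3 * ((p - 1) / 3) + 1 := by omega
    generalize (p - 1) / 3 = m at *
    have hpm' : (p : ℤ_[p]) = 3 * m + 1 := by exact_mod_cast congrArg (Nat.cast (R := ℤ_[p])) hpm
    -- Here y = p/3.
    have hm : 2 * t + m = t + p * t := by rw [hpm']; linear_combination (-(m : ℤ_[p])) * ht
    have hA : ∀ i < m, IsUnit (2 * t + (i : ℤ_[p])) := fun i hi => by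
      rw [isUnit_iff_not_prime_dvd, prime_dvd_two_thirds_add_iff ht]
      exact Nat.not_dvd_of_pos_of_lt (by omega) (by omega)
    have hB : ∀ i < m, IsUnit (1 + (i : ℤ_[p])) := fun i hi => isUnit_one_add_nat (by omega)
    have hprod := prod_unitPart_eq h2 ht (dvd_mul_right (p : ℤ_[p]) t) hm
    rw [Finset.prod_congr rfl fun i hi => unitPart_of_isUnit (hA i (Finset.mem_range.1 hi)),
      Finset.prod_congr rfl fun i hi => unitPart_of_isUnit (hB i (Finset.mem_range.1 hi))] at hprod
    have hM : (((∏ i ∈ Finset.range m, (1 + (i : ℤ_[p]))) : ℤ_[p]) : ℚ_[p]) ≠ 0 := by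
      rw [Ne, PadicInt.coe_eq_zero, Finset.prod_eq_zero_iff]
      rintro ⟨i, hi, h0⟩
      exact (hB i (Finset.mem_range.1 hi)).ne_zero h0
    have hcube := toZModPow_gammaRatio_cube (by omega) ht hm
    rw [← coe_two_mul_eq_two_thirds ht, ← coe_one, shiftedFactorial_coe, shiftedFactorial_coe, coe_one,
      sum_inv_sq_sub_eq_coe ht hA hB, hprod]
    convert padicModEq_of_toZModPow (k := 4)
      (x := -moritaGamma p t ^ 9 * (gammaRatio p (p * t) t ^ 3 *
        (1 + (p : ℤ_[p]) ^ 2 * (t ^ 2 * (sumInvSq m (2 * t) - sumInvSq m 1)))))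
      (y := -moritaGamma p t ^ 9 * 1) ?_ using 1
    · generalize (∏ i ∈ Finset.range m, (1 + (i : ℤ_[p]))) = M at *
      generalize t ^ 2 * (sumInvSq m (2 * t) - sumInvSq m 1) = S
      push_cast
      field_simp
    · push_cast
      ring
    · rw [map_mul, hcube, ← map_mul]
  · intro hmod
    have hmod' : p % 6 = 5 := hmod
    have ht := three_mul_oneThird p (by omega)
    generalize oneThird p = t at *
    have h2 : p ≠ 2 := by omega
    obtain ⟨q, hq⟩ : ∃ q, p = 3 * q + 2 := ⟨p / 3, by omega⟩
    have hpm : (2 * p - 1) / 3 = 2 * q + 1 := by omega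
    rw [hpm]
    have hq' : (p : ℤ_[p]) = 3 * q + 2 := by exact_mod_cast congrArg (Nat.cast (R := ℤ_[p])) hq
    -- Here y = 2p/3.
    have hm : 2 * t + ((2 * q + 1 : ℕ) : ℤ_[p]) = t + p * (2 * t) := by
      rw [hq']
      push_cast
      linear_combination (-(2 * q + 1 : ℤ_[p])) * ht
    have hA : ∀ i < 2 * q + 1, i ≠ q → IsUnit (2 * t + (i : ℤ_[p])) := fun i hi hne => by
      rw [isUnit_iff_not_prime_dvd, prime_dvd_two_thirds_add_iff ht]
      rintro ⟨c, hc⟩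
      -- 3i + 2 ≤ 6q + 2 < 2p leaves c = 0, which is impossible, or c = 1, which gives i = q.
      have hc2 : c < 2 := by
        by_contra! h
        have := Nat.mul_le_mul_left p h
        omega
      interval_cases c <;> omega
    have hqt : 2 * t + (q : ℤ_[p]) = p * t := by
      rw [hq']
      linear_combination (-(q : ℤ_[p])) * ht
    have hA' : ¬ IsUnit (2 * t + (q : ℤ_[p])) := by
      rw [isUnit_iff_not_prime_dvd, not_not, hqt]
      exact dvd_mul_right _ _
    have hB : ∀ i < 2 * q + 1, IsUnit (1 + (i : ℤ_[p])) := fun i hi =>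
      isUnit_one_add_nat (by omega)
    have hy : (p : ℤ_[p]) ∣ p * (2 * t) := dvd_mul_right _ _
    have hprod := prod_unitPart_eq h2 ht hy hm
    rw [Finset.prod_congr rfl fun i hi => unitPart_of_isUnit (hB i (Finset.mem_range.1 hi))] at hprod
    have hN : ∏ i ∈ Finset.range (2 * q + 1), (2 * t + (i : ℤ_[p])) =
        p * t * ∏ i ∈ Finset.range (2 * q + 1), (2 * t + (i : ℤ_[p])).unitPart := by
      have hmem : q ∈ Finset.range (2 * q + 1) := Finset.mem_range.2 (by omega)
      rw [← Finset.mul_prod_erase _ _ hmem, ← Finset.mul_prod_erase _ (fun i : ℕ =>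
        (2 * t + (i : ℤ_[p])).unitPart) hmem, unitPart_of_not_isUnit hA', one_mul, hqt]
      congr 1
      refine Finset.prod_congr rfl fun i hi => ?_
      rw [Finset.mem_erase, Finset.mem_range] at hi
      exact (unitPart_of_isUnit (hA i hi.2 hi.1)).symm
    have hM : (((∏ i ∈ Finset.range (2 * q + 1), (1 + (i : ℤ_[p]))) : ℤ_[p]) : ℚ_[p]) ≠ 0 := by
      rw [Ne, PadicInt.coe_eq_zero, Finset.prod_eq_zero_iff]
      rintro ⟨i, hi, h0⟩
      exact (hB i (Finset.mem_range.1 hi)).ne_zero h0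
    obtain ⟨c, hc⟩ := prime_sq_dvd_gammaRatio_sub_one h2 hy t
    have hD : gammaRatio p (p * (2 * t)) t = 1 + p ^ 2 * c := by linear_combination hc
    have h27 : (p : ℚ_[p]) ^ 3 / 27 = (((p : ℤ_[p]) * t) ^ 3 : ℤ_[p]) := by
      push_cast
      rw [coe_eq_one_third ht]
      ring
    rw [← coe_two_mul_eq_two_thirds ht, ← coe_one, shiftedFactorial_coe, shiftedFactorial_coe, hN, hprod, h27]
    convert padicModEq_of_toZModPow (k := 5)
      (x := -((p : ℤ_[p]) * t) ^ 3 * moritaGamma p t ^ 9 * gammaRatio p (p * (2 * t)) t ^ 3)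
      (y := -((p : ℤ_[p]) * t) ^ 3 * moritaGamma p t ^ 9) ?_ using 1
    · generalize (∏ i ∈ Finset.range (2 * q + 1), (1 + (i : ℤ_[p]))) = M at *
      push_cast
      field_simp
    · push_cast
      ring
    · rw [toZModPow_eq_iff_dvd, hD]
      -- The factor p³ is explicit; p² more comes from (1 + p²c)³ - 1.
      refine ⟨-t ^ 3 * moritaGamma p t ^ 9 * (3 * c + 3 * p ^ 2 * c ^ 2 + p ^ 4 * c ^ 3), ?_⟩
      ring
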